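/- Let $A$ be an associative ring with unit and let $(\mathfrak{C},\Delta,\epsilon)$ be an $A$-coring, i.e. an $A$-bimodule with $A$-bimodule maps $\Delta:\mathfrak{C}\to\mathfrak{C}\otimes_A\mathfrak{C}$ and $\epsilon:\mathfrak{C}\to A$ satisfying the coassociativity and counit laws. Assume that the category $\mathrm{Comod}\text{-}\mathfrak{C}$ of right $\mathfrak{C}$-comodules is abelian (this holds, for instance, if ${}_A\mathfrak{C}$ is flat). Let $G\subseteq\mathfrak{C}$ be a set of grouplike elements, i.e. elements $g$ with $\Delta(g)=g\otimes_A g$ and $\epsilon(g)=1$. For $g\in G$ let $[g]A$ be the right $\mathfrak{C}$-comodule whose underlying right $A$-module is $A$ and whose coaction is $a\mapsto 1\otimes_A ga$. For $g,h\in G$ put $A_{g,h}=\{b\in A : hb=bg\}$, so that $A_{g,g}$ is a subring of $A$, and let $$\mathfrak{R}(G)=\frac{\bigoplus_{g\in G}A\otimes_{A_{g,g}}A}{\langle\, a\otimes_{A_{h,h}}ta'-at\otimes_{A_{g,g}}a' \;:\; g,h\in G,\ t\in A_{g,h},\ a,a'\in A\,\rangle},$$ which is an $A$-coring with $\Delta(a\otimes_{A_{g,g}}a')=(a\otimes_{A_{g,g}}1)\otimes_A(1\otimes_{A_{g,g}}a')$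 and $\epsilon(a\otimes_{A_{g,g}}a')=aa'$ (on classes). If $\bigoplus_{g\in G}[g]A$ is a generator of $\mathrm{Comod}\text{-}\mathfrak{C}$, then the homomorphism of $A$-corings $$\mathsf{can}:\mathfrak{R}(G)\to\mathfrak{C},\qquad a\otimes_{A_{g,g}}a'\mapsto aga',$$ is an isomorphism of $A$-corings. -/

import Mathlib

open CategoryTheory MulOpposite
open scoped TensorProduct DirectSum

universe u v w

/-!
Right modules over a ring `B` are `Module Bᵐᵒᵖ M`; the element `m b` is `op b • m`.
A bimodule carries `Module A C`, `Module Aᵐᵒᵖ C` and `SMulCommClass A Aᵐᵒᵖ C`.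
-/

/-- The tensor product `M ⊗_B N` of a right `B`-module and a left `B`-module over a not
necessarily commutative ring `B`: the quotient of `M ⊗_ℤ N` by the subgroup generated by all
`m b ⊗ n - m ⊗ b n`. -/
def BTensor (B : Type w) (M : Type u) (N : Type v) [Ring B] [AddCommGroup M] [AddCommGroup N]
    [Module Bᵐᵒᵖ M] [Module B N] : Type (max u v) :=
  (M ⊗[ℤ] N) ⧸ AddSubgroup.closure
    {x : M ⊗[ℤ] N | ∃ (m : M) (b : B) (n : N), x = (op b • m) ⊗ₜ[ℤ] n - m ⊗ₜ[ℤ] (b • n)}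

namespace BTensor

section Basic

variable {B : Type*} {M N P M' N' : Type*} [Ring B]
  [AddCommGroup M] [AddCommGroup N] [AddCommGroup P] [AddCommGroup M'] [AddCommGroup N']
  [Module Bᵐᵒᵖ M] [Module B N] [Module Bᵐᵒᵖ M'] [Module B N']

instance instAddCommGroup : AddCommGroup (BTensor B M N) :=
  inferInstanceAs (AddCommGroup ((M ⊗[ℤ] N) ⧸ AddSubgroup.closure _))

variable (B) in
/-- The pure tensor `m ⊗ n`. -/
def tmul (m : M) (n : N) : BTensor B M N := QuotientAddGroup.mk (m ⊗ₜ[ℤ] n)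

theorem add_tmul (m m' : M) (n : N) : tmul B (m + m') n = tmul B m n + tmul B m' n :=
  congrArg QuotientAddGroup.mk (TensorProduct.add_tmul m m' n)

theorem tmul_add (m : M) (n n' : N) : tmul B m (n + n') = tmul B m n + tmul B m n' :=
  congrArg QuotientAddGroup.mk (TensorProduct.tmul_add m n n')

theorem zero_tmul (n : N) : tmul B (0 : M) n = 0 :=
  congrArg QuotientAddGroup.mk (TensorProduct.zero_tmul M n)

theorem tmul_zero (m : M) : tmul B m (0 : N) = 0 :=
  congrArg QuotientAddGroup.mk (TensorProduct.tmul_zero N m)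

theorem smul_tmul (m : M) (b : B) (n : N) : tmul B (op b • m) n = tmul B m (b • n) := by
  refine (QuotientAddGroup.eq_iff_sub_mem).2 (AddSubgroup.subset_closure ⟨m, b, n, rfl⟩)

/-- The additive map out of `M ⊗_B N` induced by a biadditive `B`-balanced map. -/
def lift (f : M →+ N →+ P) (hf : ∀ m (b : B) n, f (op b • m) n = f m (b • n)) :
    BTensor B M N →+ P :=
  QuotientAddGroup.lift _
    (TensorProduct.liftAddHom f (fun r m n => by simp))
    (by
      rw [AddSubgroup.closure_le]
      rintro _ ⟨m, b, n, rfl⟩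
      simp [hf])

@[simp] theorem lift_tmul (f : M →+ N →+ P) (hf : ∀ m (b : B) n, f (op b • m) n = f m (b • n))
    (m : M) (n : N) : lift f hf (tmul B m n) = f m n := rfl

theorem induction {p : BTensor B M N → Prop} (zero : p 0) (tm : ∀ m n, p (tmul B m n))
    (add : ∀ x y, p x → p y → p (x + y)) (x : BTensor B M N) : p x := by
  obtain ⟨x, rfl⟩ := QuotientAddGroup.mk_surjective x
  induction x using TensorProduct.induction_on with
  | zero => exact zero
  | tmul m n => exact tm m n
  | add x y hx hy => exact add _ _ hx hy

theorem hom_ext {f g : BTensor B M N →+ P} (h : ∀ m n, f (tmul B m n) = g (tmul B m n)) :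
    f = g := by
  ext x
  induction x using induction with
  | zero => simp
  | tm m n => exact h m n
  | add x y hx hy => simp [hx, hy]

/-- The map `f ⊗_B g` for a right `B`-linear `f` and a left `B`-linear `g`. -/
def map (f : M →+ M') (hf : ∀ (b : B) m, f (op b • m) = op b • f m)
    (g : N →+ N') (hg : ∀ (b : B) n, g (b • n) = b • g n) : BTensor B M N →+ BTensor B M' N' :=
  lift (AddMonoidHom.mk' (fun m => AddMonoidHom.mk' (fun n => tmul B (f m) (g n))
      (fun n n' => by simp [tmul_add])) (fun m m' => by ext n; simp [add_tmul]))
    (fun m b n => by simp [hf, hg, smul_tmul])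

@[simp] theorem map_tmul (f : M →+ M') (hf : ∀ (b : B) m, f (op b • m) = op b • f m)
    (g : N →+ N') (hg : ∀ (b : B) n, g (b • n) = b • g n) (m : M) (n : N) :
    map f hf g hg (tmul B m n) = tmul B (f m) (g n) := rfl

end Basic

section Actions

variable {A B : Type*} {M N : Type*} [Ring A] [Ring B]
  [AddCommGroup M] [AddCommGroup N] [Module Bᵐᵒᵖ M] [Module B N]

/-- Left multiplication by `a` on `M ⊗_B N`. -/
def leftMul [Module A M] [SMulCommClass A Bᵐᵒᵖ M] (a : A) :
    BTensor B M N →+ BTensor B M N :=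
  map (DistribSMul.toAddMonoidHom M a) (by intro b m; exact smul_comm a (op b) m)
    (AddMonoidHom.id N) (fun _ _ => rfl)

theorem leftMul_tmul [Module A M] [SMulCommClass A Bᵐᵒᵖ M] (a : A) (m : M) (n : N) :
    leftMul a (tmul B m n) = tmul B (a • m) n := rfl

/-- Right multiplication by `a` on `M ⊗_B N`. -/
def rightMul [Module Aᵐᵒᵖ N] [SMulCommClass B Aᵐᵒᵖ N] (a : Aᵐᵒᵖ) :
    BTensor B M N →+ BTensor B M N :=
  map (AddMonoidHom.id M) (fun _ _ => rfl)
    (DistribSMul.toAddMonoidHom N a) (by intro b n; exact (smul_comm b a n).symm)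

theorem rightMul_tmul [Module Aᵐᵒᵖ N] [SMulCommClass B Aᵐᵒᵖ N] (a : Aᵐᵒᵖ) (m : M) (n : N) :
    rightMul a (tmul B m n) = tmul B m (a • n) := rfl

/-- The left action `a (m ⊗ n) = a m ⊗ n`, as a ring homomorphism. -/
def leftHom [Module A M] [SMulCommClass A Bᵐᵒᵖ M] : A →+* AddMonoid.End (BTensor B M N) where
  toFun := leftMul
  map_one' := hom_ext (fun m n => by
    change tmul B ((1 : A) • m) n = tmul B m n
    rw [one_smul])
  map_mul' a a' := hom_ext (fun m n => by
    change tmul B ((a * a') • m) n = tmul B (a • a' • m) n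
    rw [mul_smul])
  map_zero' := hom_ext (fun m n => by
    change tmul B ((0 : A) • m) n = 0
    rw [zero_smul, zero_tmul])
  map_add' a a' := hom_ext (fun m n => by
    change tmul B ((a + a') • m) n = tmul B (a • m) n + tmul B (a' • m) n
    rw [add_smul, add_tmul])

/-- The right action `(m ⊗ n) a = m ⊗ n a`, as a ring homomorphism. -/
def rightHom [Module Aᵐᵒᵖ N] [SMulCommClass B Aᵐᵒᵖ N] :
    Aᵐᵒᵖ →+* AddMonoid.End (BTensor B M N) where
  toFun := rightMul
  map_one' := hom_ext (fun m n => by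
    change tmul B m ((1 : Aᵐᵒᵖ) • n) = tmul B m n
    rw [one_smul])
  map_mul' a a' := hom_ext (fun m n => by
    change tmul B m ((a * a') • n) = tmul B m (a • a' • n)
    rw [mul_smul])
  map_zero' := hom_ext (fun m n => by
    change tmul B m ((0 : Aᵐᵒᵖ) • n) = 0
    rw [zero_smul, tmul_zero])
  map_add' a a' := hom_ext (fun m n => by
    change tmul B m ((a + a') • n) = tmul B m (a • n) + tmul B m (a' • n)
    rw [add_smul, tmul_add])

instance (priority := 100) instLeft [Module A M] [SMulCommClass A Bᵐᵒᵖ M] :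
    Module A (BTensor B M N) :=
  Module.compHom (BTensor B M N) (leftHom (A := A) (B := B) (M := M) (N := N))

instance (priority := 200) instRight [Module Aᵐᵒᵖ N] [SMulCommClass B Aᵐᵒᵖ N] :
    Module Aᵐᵒᵖ (BTensor B M N) :=
  Module.compHom (BTensor B M N) (rightHom (A := A) (B := B) (M := M) (N := N))

theorem smul_tmul_left [Module A M] [SMulCommClass A Bᵐᵒᵖ M] (a : A) (m : M) (n : N) :
    a • tmul B m n = tmul B (a • m) n := rfl

theorem smul_tmul_right [Module Aᵐᵒᵖ N] [SMulCommClass B Aᵐᵒᵖ N] (a : A) (m : M) (n : N) :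
    op a • tmul B m n = tmul B m (op a • n) := rfl

instance instBimodule [Module A M] [SMulCommClass A Bᵐᵒᵖ M] [Module Aᵐᵒᵖ N]
    [SMulCommClass B Aᵐᵒᵖ N] : SMulCommClass A Aᵐᵒᵖ (BTensor B M N) where
  smul_comm a b x := by
    induction x using induction with
    | zero => simp
    | tm m n => rfl
    | add x y hx hy => simp [hx, hy]

theorem map_op_smul_right {M' : Type*} [AddCommGroup M'] [Module Bᵐᵒᵖ M'] [Module Aᵐᵒᵖ N]
    [SMulCommClass B Aᵐᵒᵖ N] (f : M →+ M') (hf : ∀ (b : B) m, f (op b • m) = op b • f m) (a : A)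
    (x : BTensor B M N) :
    map f hf (AddMonoidHom.id N) (fun _ _ => rfl) (op a • x) =
      op a • map f hf (AddMonoidHom.id N) (fun _ _ => rfl) x := by
  induction x using induction with
  | zero => simp
  | tm m n => rfl
  | add x y hx hy => simp only [smul_add, map_add, hx, hy]

end Actions

section Assoc

variable {A : Type*} {M C D : Type*} [Ring A] [AddCommGroup M] [AddCommGroup C] [AddCommGroup D]
  [Module Aᵐᵒᵖ M] [Module A C] [Module Aᵐᵒᵖ C] [SMulCommClass A Aᵐᵒᵖ C] [Module A D]

/-- The map `d ↦ m ⊗ (c ⊗ d)`, biadditive in `m` and `c`. -/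
def assocAux : M →+ C →+ D →+ BTensor A M (BTensor A C D) :=
  AddMonoidHom.mk' (fun m => AddMonoidHom.mk' (fun c => AddMonoidHom.mk'
      (fun d => tmul A m (tmul A c d))
      (fun d d' => by rw [tmul_add, tmul_add]))
      (fun c c' => by
        ext d
        change tmul A m (tmul A (c + c') d) = tmul A m (tmul A c d) + tmul A m (tmul A c' d)
        rw [add_tmul, tmul_add]))
    (fun m m' => by
      ext c d
      change tmul A (m + m') (tmul A c d) = tmul A m (tmul A c d) + tmul A m' (tmul A c d)
      rw [add_tmul])

theorem assocAux_apply (m : M) (c : C) (d : D) :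
    assocAux (A := A) m c d = tmul A m (tmul A c d) := rfl

/-- The map `(m ⊗ c, d) ↦ m ⊗ (c ⊗ d)`. -/
def assocAux' : BTensor A M C →+ D →+ BTensor A M (BTensor A C D) :=
  lift assocAux (fun m a c => by
    ext d
    rw [assocAux_apply, assocAux_apply, smul_tmul, smul_tmul_left])

theorem assocAux'_tmul (m : M) (c : C) (d : D) :
    assocAux' (tmul A m c) d = tmul A m (tmul A c d) := rfl

variable (A M C D) in
/-- The associativity map `(M ⊗_A C) ⊗_A D → M ⊗_A (C ⊗_A D)`. -/
def assoc : BTensor A (BTensor A M C) D →+ BTensor A M (BTensor A C D) :=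
  lift assocAux' (fun x a d => by
    induction x using induction with
    | zero => simp
    | tm m c => rw [smul_tmul_right, assocAux'_tmul, assocAux'_tmul, smul_tmul]
    | add x y hx hy => rw [smul_add, map_add, map_add, AddMonoidHom.add_apply, hx, hy]; rfl)

@[simp] theorem assoc_tmul (m : M) (c : C) (d : D) :
    assoc A M C D (tmul A (tmul A m c) d) = tmul A m (tmul A c d) := rfl

end Assoc

section Contract

variable {A : Type*} {M C : Type*} [Ring A] [AddCommGroup M] [AddCommGroup C]

/-- `M ⊗_A C → M ⊗_A A ≅ M`, `m ⊗ c ↦ m e(c)`, for a left `A`-linear map `e : C → A`. -/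
def contractRight [Module A C] [Module Aᵐᵒᵖ M] (e : C →+ A) (he : ∀ (a : A) c, e (a • c) = a * e c) :
    BTensor A M C →+ M :=
  lift (AddMonoidHom.mk' (fun m => AddMonoidHom.mk' (fun c => op (e c) • m)
      (fun c c' => by simp [add_smul])) (fun m m' => by ext c; simp))
    (fun m a c => by simp [he, mul_smul])

@[simp] theorem contractRight_tmul [Module A C] [Module Aᵐᵒᵖ M] (e : C →+ A)
    (he : ∀ (a : A) c, e (a • c) = a * e c) (m : M) (c : C) :
    contractRight e he (tmul A m c) = op (e c) • m := rfl

/-- `C ⊗_A M → A ⊗_A M ≅ M`, `c ⊗ m ↦ e(c) m`, for a right `A`-linear map `e : C → A`. -/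
def contractLeft [Module Aᵐᵒᵖ C] [Module A M] (e : C →+ A)
    (he : ∀ (a : A) c, e (op a • c) = e c * a) : BTensor A C M →+ M :=
  lift (AddMonoidHom.mk' (fun c => AddMonoidHom.mk' (fun m => e c • m)
      (fun c c' => by simp)) (fun m m' => by ext c; simp [add_smul]))
    (fun m a c => by simp [he, mul_smul])

@[simp] theorem contractLeft_tmul [Module Aᵐᵒᵖ C] [Module A M] (e : C →+ A)
    (he : ∀ (a : A) c, e (op a • c) = e c * a) (c : C) (m : M) :
    contractLeft e he (tmul A c m) = e c • m := rfl

end Contract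

end BTensor

/-- An `A`-coring structure on the `A`-bimodule `C`. -/
class ACoring (A : Type u) (C : Type v) [Ring A] [AddCommGroup C] [Module A C] [Module Aᵐᵒᵖ C]
    [SMulCommClass A Aᵐᵒᵖ C] where
  /-- comultiplication, a map of `A`-bimodules -/
  comul : C →+ BTensor A C C
  comul_smul : ∀ (a : A) (c : C), comul (a • c) = a • comul c
  comul_op_smul : ∀ (a : A) (c : C), comul (op a • c) = op a • comul c
  /-- counit, a map of `A`-bimodules -/
  counit : C →+ A
  counit_smul : ∀ (a : A) (c : C), counit (a • c) = a * counit c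
  counit_op_smul : ∀ (a : A) (c : C), counit (op a • c) = counit c * a
  coassoc : ∀ c : C,
    BTensor.assoc A C C C
        (BTensor.map comul comul_op_smul (AddMonoidHom.id C) (fun _ _ => rfl) (comul c)) =
      BTensor.map (AddMonoidHom.id C) (fun _ _ => rfl) comul comul_smul (comul c)
  counit_left : ∀ c : C, BTensor.contractLeft counit counit_op_smul (comul c) = c
  counit_right : ∀ c : C, BTensor.contractRight counit counit_smul (comul c) = c

/-- A homomorphism of `A`-corings: a homomorphism of `A`-bimodules that commutes with
comultiplications and counits. -/
structure CoringHom (A : Type u) (C : Type v) (D : Type w) [Ring A]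
    [AddCommGroup C] [Module A C] [Module Aᵐᵒᵖ C] [SMulCommClass A Aᵐᵒᵖ C] [ACoring A C]
    [AddCommGroup D] [Module A D] [Module Aᵐᵒᵖ D] [SMulCommClass A Aᵐᵒᵖ D] [ACoring A D] where
  toHom : C →+ D
  map_smul : ∀ (a : A) (c : C), toHom (a • c) = a • toHom c
  map_op_smul : ∀ (a : A) (c : C), toHom (op a • c) = op a • toHom c
  map_comul : ∀ c : C, ACoring.comul (A := A) (toHom c) =
    BTensor.map toHom map_op_smul toHom map_smul (ACoring.comul c)
  map_counit : ∀ c : C, ACoring.counit (A := A) (toHom c) = ACoring.counit c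

/-- `f` is an isomorphism of `A`-corings: it has a two-sided inverse that is a homomorphism of
`A`-corings. -/
def CoringHom.IsIsomorphism {A : Type u} {C : Type v} {D : Type w} [Ring A]
    [AddCommGroup C] [Module A C] [Module Aᵐᵒᵖ C] [SMulCommClass A Aᵐᵒᵖ C] [ACoring A C]
    [AddCommGroup D] [Module A D] [Module Aᵐᵒᵖ D] [SMulCommClass A Aᵐᵒᵖ D] [ACoring A D]
    (f : CoringHom A C D) : Prop :=
  ∃ k : CoringHom A D C, (∀ c, k.toHom (f.toHom c) = c) ∧ (∀ d, f.toHom (k.toHom d) = d)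

section Comodules

variable (A C : Type u) [Ring A] [AddCommGroup C] [Module A C] [Module Aᵐᵒᵖ C]
  [SMulCommClass A Aᵐᵒᵖ C] [ACoring A C]

/-- A right comodule over the `A`-coring `C`. -/
structure RightComodule where
  /-- the underlying right `A`-module -/
  carrier : Type u
  [addCommGroup : AddCommGroup carrier]
  [module : Module Aᵐᵒᵖ carrier]
  /-- the coaction, a map of right `A`-modules -/
  coact : carrier →+ BTensor A carrier C
  coact_op_smul : ∀ (a : A) (m : carrier), coact (op a • m) = op a • coact m
  coassoc : ∀ m : carrier,
    BTensor.assoc A carrier C C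
        (BTensor.map coact coact_op_smul (AddMonoidHom.id C) (fun _ _ => rfl) (coact m)) =
      BTensor.map (AddMonoidHom.id carrier) (fun _ _ => rfl)
        (ACoring.comul (A := A) (C := C)) ACoring.comul_smul (coact m)
  counit : ∀ m : carrier,
    BTensor.contractRight (ACoring.counit (A := A) (C := C)) ACoring.counit_smul (coact m) = m

namespace RightComodule

attribute [instance] addCommGroup module

variable {A C}

/-- A homomorphism of right comodules: a homomorphism of right `A`-modules that commutes with
the coactions. -/
@[ext]
structure Hom (M N : RightComodule A C) where
  toHom : M.carrier →+ N.carrier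
  map_op_smul : ∀ (a : A) (m : M.carrier), toHom (op a • m) = op a • toHom m
  map_coact : ∀ m : M.carrier, N.coact (toHom m) =
    BTensor.map toHom map_op_smul (AddMonoidHom.id C) (fun _ _ => rfl) (M.coact m)

/-- The category of right comodules over `C`. -/
instance : Category (RightComodule A C) where
  Hom M N := Hom M N
  id M :=
    { toHom := AddMonoidHom.id _
      map_op_smul := fun _ _ => rfl
      map_coact := fun m => by
        have : BTensor.map (B := A) (AddMonoidHom.id M.carrier) (fun _ _ => rfl)
            (AddMonoidHom.id C) (fun _ _ => rfl) = AddMonoidHom.id _ :=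
          BTensor.hom_ext (fun m n => rfl)
        rw [this]; rfl }
  comp {M N P} f k :=
    { toHom := k.toHom.comp f.toHom
      map_op_smul := fun a m => by simp [f.map_op_smul, k.map_op_smul]
      map_coact := fun m => by
        have : BTensor.map (B := A) (k.toHom.comp f.toHom)
            (fun a m => by simp [f.map_op_smul, k.map_op_smul])
            (AddMonoidHom.id C) (fun _ _ => rfl) =
            (BTensor.map (B := A) k.toHom k.map_op_smul
              (AddMonoidHom.id C) (fun _ _ => rfl)).comp
            (BTensor.map (B := A) f.toHom f.map_op_smul
              (AddMonoidHom.id C) (fun _ _ => rfl)) :=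
          BTensor.hom_ext (fun m n => rfl)
        rw [this]
        simp [k.map_coact, f.map_coact] }

theorem of_op_smul {ι : Type u} [DecidableEq ι] (M : ι → RightComodule A C) (i : ι) (a : A)
    (m : (M i).carrier) :
    DirectSum.of (fun i => (M i).carrier) i (op a • m) =
      op a • DirectSum.of (fun i => (M i).carrier) i m :=
  (DirectSum.lof Aᵐᵒᵖ ι (fun i => (M i).carrier) i).map_smul (op a) m

/-- The coaction of a direct sum. -/
def sumCoact {ι : Type u} [DecidableEq ι] (M : ι → RightComodule A C) :
    (⨁ i, (M i).carrier) →+ BTensor A (⨁ i, (M i).carrier) C :=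
  DirectSum.toAddMonoid fun i =>
    (BTensor.map (DirectSum.of (fun i => (M i).carrier) i)
      (of_op_smul M i)
      (AddMonoidHom.id C) (fun _ _ => rfl)).comp (M i).coact

theorem sumCoact_of {ι : Type u} [DecidableEq ι] (M : ι → RightComodule A C) (i : ι)
    (m : (M i).carrier) :
    sumCoact M (DirectSum.of (fun i => (M i).carrier) i m) =
      BTensor.map (DirectSum.of (fun i => (M i).carrier) i)
        (of_op_smul M i)
        (AddMonoidHom.id C) (fun _ _ => rfl) ((M i).coact m) := by
  simp [sumCoact]

theorem sumCoact_op_smul {ι : Type u} [DecidableEq ι] (M : ι → RightComodule A C) (a : A)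
    (m : ⨁ i, (M i).carrier) : sumCoact M (op a • m) = op a • sumCoact M m := by
  induction m using DirectSum.induction_on with
  | zero => simp
  | of i x =>
    rw [← of_op_smul, sumCoact_of, sumCoact_of, (M i).coact_op_smul, BTensor.map_op_smul_right]
  | add x y hx hy => simp only [smul_add, map_add, hx, hy]

/-- The direct sum (coproduct) of a family of right comodules. -/
def directSum {ι : Type u} [DecidableEq ι] (M : ι → RightComodule A C) : RightComodule A C where
  carrier := ⨁ i, (M i).carrier
  coact := sumCoact M
  coact_op_smul := sumCoact_op_smul M
  coassoc m := by
    induction m using DirectSum.induction_on with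
    | zero => simp
    | of i x =>
      rw [sumCoact_of]
      have h := congrArg (BTensor.map (DirectSum.of (fun i => (M i).carrier) i) (of_op_smul M i)
        (AddMonoidHom.id (BTensor A C C)) (fun _ _ => rfl)) ((M i).coassoc x)
      revert h
      generalize (M i).coact x = y
      intro h
      have e1 : ∀ y : BTensor A (M i).carrier C,
          BTensor.map (AddMonoidHom.id _) (fun _ _ => rfl)
            (ACoring.comul (A := A) (C := C)) ACoring.comul_smul
            (BTensor.map (DirectSum.of (fun i => (M i).carrier) i) (of_op_smul M i)
              (AddMonoidHom.id C) (fun _ _ => rfl) y) =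
          BTensor.map (DirectSum.of (fun i => (M i).carrier) i) (of_op_smul M i)
            (AddMonoidHom.id (BTensor A C C)) (fun _ _ => rfl)
            (BTensor.map (AddMonoidHom.id _) (fun _ _ => rfl)
              (ACoring.comul (A := A) (C := C)) ACoring.comul_smul y) := by
        intro y
        induction y using BTensor.induction with
        | zero => simp
        | tm m n => rfl
        | add x y hx hy => simp only [map_add, hx, hy]
      have e3 : ∀ (z : BTensor A (M i).carrier C) (c : C),
          BTensor.assoc A _ C C (BTensor.tmul A
            (BTensor.map (DirectSum.of (fun i => (M i).carrier) i) (of_op_smul M i)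
              (AddMonoidHom.id C) (fun _ _ => rfl) z) c) =
          BTensor.map (DirectSum.of (fun i => (M i).carrier) i) (of_op_smul M i)
            (AddMonoidHom.id (BTensor A C C)) (fun _ _ => rfl)
            (BTensor.assoc A _ C C (BTensor.tmul A z c)) := by
        intro z c
        induction z using BTensor.induction with
        | zero => simp [BTensor.zero_tmul]
        | tm m n => rfl
        | add x y hx hy => simp only [map_add, BTensor.add_tmul, hx, hy]
      have e2 : ∀ y : BTensor A (M i).carrier C,
          BTensor.assoc A _ C C
            (BTensor.map (sumCoact M) (sumCoact_op_smul M) (AddMonoidHom.id C) (fun _ _ => rfl)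
              (BTensor.map (DirectSum.of (fun i => (M i).carrier) i) (of_op_smul M i)
                (AddMonoidHom.id C) (fun _ _ => rfl) y)) =
          BTensor.map (DirectSum.of (fun i => (M i).carrier) i) (of_op_smul M i)
            (AddMonoidHom.id (BTensor A C C)) (fun _ _ => rfl)
            (BTensor.assoc A _ C C
              (BTensor.map (M i).coact (M i).coact_op_smul (AddMonoidHom.id C)
                (fun _ _ => rfl) y)) := by
        intro y
        induction y using BTensor.induction with
        | zero => simp
        | tm m n =>
          simp only [BTensor.map_tmul, AddMonoidHom.id_apply, sumCoact_of, e3]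
        | add x y hx hy => simp only [map_add, hx, hy]
      exact (e2 y).trans (h.trans (e1 y).symm)
    | add x y hx hy => simp only [map_add, hx, hy]
  counit m := by
    induction m using DirectSum.induction_on with
    | zero => simp
    | of i x =>
      rw [sumCoact_of]
      have h := congrArg (DirectSum.of (fun i => (M i).carrier) i) ((M i).counit x)
      revert h
      generalize hy : (M i).coact x = y
      intro h
      refine Eq.trans ?_ h
      clear h hy
      induction y using BTensor.induction with
      | zero => simp
      | tm m n => exact (of_op_smul M i _ _).symm
      | add x y hx hy => simp only [map_add, hx, hy]
    | add x y hx hy => simp only [map_add, hx, hy]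

end RightComodule

end Comodules

section Grouplike

variable {A C : Type u} [Ring A] [AddCommGroup C] [Module A C] [Module Aᵐᵒᵖ C]
  [SMulCommClass A Aᵐᵒᵖ C] [ACoring A C]

variable (A) in
/-- Grouplike elements of an `A`-coring. -/
structure IsGrouplike (g : C) : Prop where
  comul : ACoring.comul (A := A) g = BTensor.tmul A g g
  counit : ACoring.counit (A := A) g = 1

/-- The right comodule `[g]A`: the right module `A` with coaction `a ↦ 1 ⊗ g a`. -/
def grouplikeComodule (g : C) (hg : IsGrouplike A g) : RightComodule A C where
  carrier := A
  coact := AddMonoidHom.mk' (fun a => BTensor.tmul A 1 (op a • g))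
    (fun a b => by simp [add_smul, BTensor.tmul_add])
  coact_op_smul a b := by
    simp [mul_smul, BTensor.smul_tmul_right]
  coassoc a := by
    simp [ACoring.comul_op_smul, hg.comul, BTensor.smul_tmul_right]
  counit a := by
    simp [ACoring.counit_op_smul, hg.counit]

/-- The right comodule `⨁_{g ∈ G} [g]A`. -/
noncomputable def grouplikeSum (G : Set C) (hG : ∀ g ∈ G, IsGrouplike A g) : RightComodule A C :=
  letI : DecidableEq G := Classical.decEq G
  RightComodule.directSum fun g : G => grouplikeComodule g.1 (hG g.1 g.2)

variable (A) in
/-- `A_{g,h} = {b ∈ A | h b = b g}`. -/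
def intertwiner (g h : C) : Set A := {b | op b • h = b • g}

variable (A) in
/-- `A_{g,g}` as a subring of `A`. -/
def centralizerRing (g : C) : Subring A where
  carrier := intertwiner A g g
  mul_mem' {a b} ha hb := by
    simp only [intertwiner, Set.mem_ofPred_eq] at *
    rw [MulOpposite.op_mul, mul_smul, ha, smul_comm a (op b) g |>.symm, hb, mul_smul]
  one_mem' := by simp [intertwiner]
  add_mem' {a b} ha hb := by
    simp only [intertwiner, Set.mem_ofPred_eq] at *
    rw [MulOpposite.op_add, add_smul, ha, hb, add_smul]
  zero_mem' := by simp [intertwiner]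
  neg_mem' {a} ha := by
    simp only [intertwiner, Set.mem_ofPred_eq] at *
    rw [MulOpposite.op_neg, neg_smul, ha, neg_smul]

end Grouplike

/-- `A` as a right module over a subring `B`. -/
instance Subring.rightModule {A : Type*} [Ring A] (B : Subring A) : Module (↥B)ᵐᵒᵖ A :=
  Module.compHom A B.subtype.op

theorem Subring.op_smul_eq {A : Type*} [Ring A] (B : Subring A) (b : B) (a : A) :
    op b • a = a * b := rfl

instance Subring.leftRightComm {A : Type*} [Ring A] (B : Subring A) :
    SMulCommClass A (↥B)ᵐᵒᵖ A where
  smul_comm a b x := by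
    obtain ⟨b, rfl⟩ := op_surjective b
    simp only [Subring.op_smul_eq, smul_eq_mul, mul_assoc]

instance Subring.rightLeftComm {A : Type*} [Ring A] (B : Subring A) :
    SMulCommClass (↥B) Aᵐᵒᵖ A where
  smul_comm b a x := by
    simp only [Subring.smul_def, smul_eq_mul, MulOpposite.smul_eq_mul_unop, mul_assoc]

section CanonicalCoring

variable {A C : Type u} [Ring A] [AddCommGroup C] [Module A C] [Module Aᵐᵒᵖ C]
  [SMulCommClass A Aᵐᵒᵖ C]

theorem centralizerRing_mem {g : C} (b : centralizerRing A g) : (b : A) ∈ intertwiner A g g := b.2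

variable (A) in
/-- The underlying bimodule `A ⊗_{A_{g,g}} A` of Sweedler's canonical coring. -/
abbrev Sweedler (g : C) : Type u := BTensor (centralizerRing A g) A A

variable (A) in
/-- The bimodule `⨁_{g ∈ G} A ⊗_{A_{g,g}} A`. -/
abbrev SweedlerSum (G : Set C) : Type u := ⨁ g : G, Sweedler A g.1

open Classical in
/-- The element `a ⊗_{A_{g,g}} a'` of the direct sum. -/
noncomputable def SweedlerSum.gen {G : Set C} (g : G) (a a' : A) : SweedlerSum A G :=
  DirectSum.of (fun g : G => Sweedler A g.1) g (BTensor.tmul (centralizerRing A g.1) a a')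

variable (A) in
/-- The subgroup `𝔍`, generated by all `a ⊗_{A_{h,h}} t a' - a t ⊗_{A_{g,g}} a'` with
`t ∈ A_{g,h}`. -/
noncomputable def canonicalCoideal (G : Set C) : AddSubgroup (SweedlerSum A G) :=
  AddSubgroup.closure {x | ∃ (g h : G) (t a a' : A), t ∈ intertwiner A g.1 h.1 ∧
    x = SweedlerSum.gen h a (t * a') - SweedlerSum.gen g (a * t) a'}

variable (A) in
/-- `ℜ(G) = (⨁_{g ∈ G} A ⊗_{A_{g,g}} A) / 𝔍`. -/
def CanonicalCoring (G : Set C) : Type u := SweedlerSum A G ⧸ canonicalCoideal A G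

namespace CanonicalCoring

variable {G : Set C}

noncomputable instance : AddCommGroup (CanonicalCoring A G) :=
  inferInstanceAs (AddCommGroup (SweedlerSum A G ⧸ canonicalCoideal A G))

/-- The class of `a ⊗_{A_{g,g}} a'` in `ℜ(G)`. -/
noncomputable def mk (g : G) (a a' : A) : CanonicalCoring A G :=
  QuotientAddGroup.mk (SweedlerSum.gen g a a')

theorem sweedlerSum_induction {p : SweedlerSum A G → Prop} (zero : p 0)
    (gen : ∀ g a a', p (SweedlerSum.gen g a a')) (add : ∀ x y, p x → p y → p (x + y))
    (x : SweedlerSum A G) : p x := by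
  classical
  induction x using DirectSum.induction_on with
  | zero => exact zero
  | of g x =>
    induction x using BTensor.induction with
    | zero => simpa using zero
    | tm a a' =>
      have h := gen g a a'
      rw [SweedlerSum.gen] at h
      convert h
    | add x y hx hy => rw [map_add]; exact add _ _ hx hy
  | add x y hx hy => exact add _ _ hx hy

theorem induction {p : CanonicalCoring A G → Prop} (zero : p 0) (mk : ∀ g a a', p (mk g a a'))
    (add : ∀ x y, p x → p y → p (x + y)) (x : CanonicalCoring A G) : p x := by
  obtain ⟨x, rfl⟩ := QuotientAddGroup.mk_surjective x
  induction x using sweedlerSum_induction with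
  | zero => exact zero
  | gen g a a' => exact mk g a a'
  | add x y hx hy => exact add _ _ hx hy

theorem hom_ext {P : Type*} [AddCommGroup P] {f k : CanonicalCoring A G →+ P}
    (h : ∀ g a a', f (mk g a a') = k (mk g a a')) : f = k := by
  ext x
  induction x using induction with
  | zero => simp
  | mk g a a' => exact h g a a'
  | add x y hx hy => simp [hx, hy]

theorem mk_add_left (g : G) (a b a' : A) : mk g (a + b) a' = mk g a a' + mk g b a' := by
  classical
  simp only [mk, SweedlerSum.gen, BTensor.add_tmul, map_add]
  rfl

theorem mk_add_right (g : G) (a a' b : A) : mk g a (a' + b) = mk g a a' + mk g a b := by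
  classical
  simp only [mk, SweedlerSum.gen, BTensor.tmul_add, map_add]
  rfl

theorem mk_intertwine (g h : G) (t : A) (ht : t ∈ intertwiner A g.1 h.1) (a a' : A) :
    mk h a (t * a') = mk g (a * t) a' :=
  QuotientAddGroup.eq_iff_sub_mem.2 (AddSubgroup.subset_closure ⟨g, h, t, a, a', ht, rfl⟩)

open Classical in
/-- The additive map out of `ℜ(G)` given on the classes of `a ⊗_{A_{g,g}} a'` by a family of
biadditive maps compatible with the defining relations. -/
noncomputable def lift {P : Type*} [AddCommGroup P] (f : G → A →+ A →+ P)
    (hf : ∀ (g h : G) (t : A), t ∈ intertwiner A g.1 h.1 → ∀ a a',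
      f h a (t * a') = f g (a * t) a') : CanonicalCoring A G →+ P :=
  QuotientAddGroup.lift (canonicalCoideal A G)
    (DirectSum.toAddMonoid fun g : G =>
      BTensor.lift (B := centralizerRing A g.1) (f g) (fun a b a' => (hf g g b (centralizerRing_mem b) a a').symm))
    (by
      rw [canonicalCoideal, AddSubgroup.closure_le]
      rintro _ ⟨g, h, t, a, a', ht, rfl⟩
      rw [SetLike.mem_coe, AddMonoidHom.mem_ker, map_sub, SweedlerSum.gen, SweedlerSum.gen,
        DirectSum.toAddMonoid_of, DirectSum.toAddMonoid_of]
      exact sub_eq_zero.2 (hf g h t ht a a'))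

@[simp] theorem lift_mk {P : Type*} [AddCommGroup P] (f : G → A →+ A →+ P)
    (hf : ∀ (g h : G) (t : A), t ∈ intertwiner A g.1 h.1 → ∀ a a',
      f h a (t * a') = f g (a * t) a') (g : G) (a a' : A) :
    lift f hf (mk g a a') = f g a a' := by
  classical
  change DirectSum.toAddMonoid (fun g : G =>
    BTensor.lift (B := centralizerRing A g.1) (f g) (fun a b a' => (hf g g b (centralizerRing_mem b) a a').symm))
    (SweedlerSum.gen g a a') = _
  rw [SweedlerSum.gen]
  erw [DirectSum.toAddMonoid_of]
  rfl

theorem mk_zero_left (g : G) (a' : A) : mk g 0 a' = 0 := by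
  have := mk_add_left g 0 0 a'
  simpa using this

theorem mk_zero_right (g : G) (a : A) : mk g a 0 = 0 := by
  have := mk_add_right g a 0 0
  simpa using this

/-- Left multiplication by `b` on `ℜ(G)`. -/
noncomputable def leftMul (b : A) : CanonicalCoring A G →+ CanonicalCoring A G :=
  lift (fun g => AddMonoidHom.mk' (fun a => AddMonoidHom.mk' (fun a' => mk g (b * a) a')
      (fun x y => mk_add_right _ _ _ _)) (fun x y => by ext; simp [mul_add, mk_add_left]))
    (fun g h t ht a a' => by simp [mk_intertwine g h t ht, mul_assoc])

theorem leftMul_mk (b : A) (g : G) (a a' : A) : leftMul b (mk g a a') = mk g (b * a) a' :=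
  lift_mk (hf := _) ..

/-- Right multiplication by `b` on `ℜ(G)`. -/
noncomputable def rightMul (b : A) : CanonicalCoring A G →+ CanonicalCoring A G :=
  lift (fun g => AddMonoidHom.mk' (fun a => AddMonoidHom.mk' (fun a' => mk g a (a' * b))
      (fun x y => by simp [add_mul, mk_add_right])) (fun x y => by ext; simp [mk_add_left]))
    (fun g h t ht a a' => by simp [mk_intertwine g h t ht, mul_assoc])

theorem rightMul_mk (b : A) (g : G) (a a' : A) : rightMul b (mk g a a') = mk g a (a' * b) :=
  lift_mk (hf := _) ..

/-- The left action `b (a ⊗ a') = b a ⊗ a'`, as a ring homomorphism. -/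
noncomputable def leftHom : A →+* AddMonoid.End (CanonicalCoring A G) where
  toFun := leftMul
  map_one' := hom_ext (fun g a a' => by
    change leftMul 1 (mk g a a') = mk g a a'
    simp [leftMul_mk])
  map_mul' x y := hom_ext (fun g a a' => by
    change leftMul (x * y) (mk g a a') = leftMul x (leftMul y (mk g a a'))
    simp [leftMul_mk, mul_assoc])
  map_zero' := hom_ext (fun g a a' => by
    change leftMul 0 (mk g a a') = 0
    simp [leftMul_mk, mk_zero_left])
  map_add' x y := hom_ext (fun g a a' => by
    change leftMul (x + y) (mk g a a') = leftMul x (mk g a a') + leftMul y (mk g a a')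
    simp [leftMul_mk, add_mul, mk_add_left])

/-- The right action `(a ⊗ a') b = a ⊗ a' b`, as a ring homomorphism. -/
noncomputable def rightHom : Aᵐᵒᵖ →+* AddMonoid.End (CanonicalCoring A G) where
  toFun b := rightMul b.unop
  map_one' := hom_ext (fun g a a' => by
    change rightMul 1 (mk g a a') = mk g a a'
    simp [rightMul_mk])
  map_mul' x y := hom_ext (fun g a a' => by
    change rightMul (y.unop * x.unop) (mk g a a') = rightMul x.unop (rightMul y.unop (mk g a a'))
    simp [rightMul_mk, mul_assoc])
  map_zero' := hom_ext (fun g a a' => by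
    change rightMul 0 (mk g a a') = 0
    simp [rightMul_mk, mk_zero_right])
  map_add' x y := hom_ext (fun g a a' => by
    change rightMul (x.unop + y.unop) (mk g a a') =
      rightMul x.unop (mk g a a') + rightMul y.unop (mk g a a')
    simp [rightMul_mk, mul_add, mk_add_right])

noncomputable instance : Module A (CanonicalCoring A G) :=
  Module.compHom (CanonicalCoring A G) (leftHom (A := A) (G := G))

noncomputable instance : Module Aᵐᵒᵖ (CanonicalCoring A G) :=
  Module.compHom (CanonicalCoring A G) (rightHom (A := A) (G := G))

@[simp] theorem smul_mk (b : A) (g : G) (a a' : A) : b • mk g a a' = mk g (b * a) a' :=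
  leftMul_mk b g a a'

@[simp] theorem op_smul_mk (b : A) (g : G) (a a' : A) : op b • mk g a a' = mk g a (a' * b) :=
  rightMul_mk b g a a'

instance : SMulCommClass A Aᵐᵒᵖ (CanonicalCoring A G) where
  smul_comm x y z := by
    obtain ⟨y, rfl⟩ := op_surjective y
    induction z using induction with
    | zero => simp
    | mk g a a' => simp
    | add z z' hz hz' => simp only [smul_add, hz, hz']

/-- The comultiplication of `ℜ(G)`, induced by those of Sweedler's canonical corings:
`Δ(a ⊗ a') = (a ⊗ 1) ⊗_A (1 ⊗ a')`. -/
noncomputable def comul :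
    CanonicalCoring A G →+ BTensor A (CanonicalCoring A G) (CanonicalCoring A G) :=
  lift (fun g => AddMonoidHom.mk' (fun a => AddMonoidHom.mk'
      (fun a' => BTensor.tmul A (mk g a 1) (mk g 1 a'))
      (fun x y => by simp [mk_add_right, BTensor.tmul_add]))
      (fun x y => by ext; simp [mk_add_left, BTensor.add_tmul]))
    (fun g h t ht a a' => by
      have e1 : mk h 1 (t * a') = t • mk g 1 a' := by
        simp [mk_intertwine g h t ht]
      have e2 : op t • mk h a 1 = mk g (a * t) 1 := by
        have := mk_intertwine g h t ht a 1
        simpa using this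
      change BTensor.tmul A (mk h a 1) (mk h 1 (t * a')) =
        BTensor.tmul A (mk g (a * t) 1) (mk g 1 a')
      rw [e1, ← e2, BTensor.smul_tmul])

@[simp] theorem comul_mk (g : G) (a a' : A) :
    comul (mk g a a') = BTensor.tmul A (mk g a 1) (mk g 1 a') := lift_mk _ _ _ _ _

/-- The counit of `ℜ(G)`, induced by those of Sweedler's canonical corings: `ε(a ⊗ a') = a a'`. -/
noncomputable def counit : CanonicalCoring A G →+ A :=
  lift (fun _ => AddMonoidHom.mul) (fun g h t ht a a' => by simp [mul_assoc])

@[simp] theorem counit_mk (g : G) (a a' : A) : counit (mk g a a') = a * a' := lift_mk _ _ _ _ _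

/-- The coring structure of `ℜ(G)`, as a factor coring of the coproduct of Sweedler's canonical
corings. -/
noncomputable instance : ACoring A (CanonicalCoring A G) where
  comul := comul
  comul_smul b x := by
    induction x using induction with
    | zero => simp
    | mk g a a' => simp [BTensor.smul_tmul_left]
    | add x y hx hy => simp only [smul_add, map_add, hx, hy]
  comul_op_smul b x := by
    induction x using induction with
    | zero => simp
    | mk g a a' => simp [BTensor.smul_tmul_right]
    | add x y hx hy => simp only [smul_add, map_add, hx, hy]
  counit := counit
  counit_smul b x := by
    induction x using induction with
    | zero => simp
    | mk g a a' => simp [mul_assoc]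
    | add x y hx hy => simp only [smul_add, map_add, mul_add, hx, hy]
  counit_op_smul b x := by
    induction x using induction with
    | zero => simp
    | mk g a a' => simp [mul_assoc]
    | add x y hx hy => simp only [smul_add, map_add, add_mul, hx, hy]
  coassoc x := by
    induction x using induction with
    | zero => simp
    | mk g a a' => simp
    | add x y hx hy => simp only [map_add, hx, hy]
  counit_left x := by
    induction x using induction with
    | zero => simp
    | mk g a a' => simp
    | add x y hx hy => simp only [map_add, hx, hy]
  counit_right x := by
    induction x using induction with
    | zero => simp
    | mk g a a' => simp
    | add x y hx hy => simp only [map_add, hx, hy]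

/-- The additive map `ℜ(G) → C`, `a ⊗_{A_{g,g}} a' ↦ a g a'`. -/
noncomputable def canAddHom (G : Set C) : CanonicalCoring A G →+ C :=
  lift (fun g => AddMonoidHom.mk' (fun a => AddMonoidHom.mk' (fun a' => a • op a' • g.1)
      (fun x y => by simp [add_smul])) (fun x y => by ext; simp [add_smul]))
    (fun g h t ht a a' => by
      have ht' : op t • h.1 = t • g.1 := ht
      simp only [AddMonoidHom.mk'_apply, op_mul, mul_smul, ht']
      rw [smul_comm t (op a') g.1])

@[simp] theorem canAddHom_mk (g : G) (a a' : A) :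
    canAddHom G (mk g a a') = a • op a' • g.1 := lift_mk _ _ _ _ _

/-- The canonical homomorphism of corings `can : ℜ(G) → C`, `a ⊗_{A_{g,g}} a' ↦ a g a'`. -/
noncomputable def can [ACoring A C] (G : Set C) (hG : ∀ g ∈ G, IsGrouplike A g) :
    CoringHom A (CanonicalCoring A G) C where
  toHom := canAddHom G
  map_smul b x := by
    induction x using induction with
    | zero => simp
    | mk g a a' => simp [mul_smul]
    | add x y hx hy => simp only [smul_add, map_add, hx, hy]
  map_op_smul b x := by
    induction x using induction with
    | zero => simp
    | mk g a a' => simp [mul_smul, smul_comm]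
    | add x y hx hy => simp only [smul_add, map_add, hx, hy]
  map_comul x := by
    induction x using induction with
    | zero => simp
    | mk g a a' =>
      change _ = BTensor.map _ _ _ _ (comul (mk g a a'))
      simp [ACoring.comul_smul, ACoring.comul_op_smul, (hG g.1 g.2).comul,
        BTensor.smul_tmul_left, BTensor.smul_tmul_right]
    | add x y hx hy => simp only [map_add, hx, hy]
  map_counit x := by
    induction x using induction with
    | zero => simp
    | mk g a a' =>
      change _ = counit (mk g a a')
      simp [ACoring.counit_smul, ACoring.counit_op_smul, (hG g.1 g.2).counit]
    | add x y hx hy => simp only [map_add, hx, hy]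

end CanonicalCoring

end CanonicalCoring

/-! Call `u` in a comodule `X` a `g`-element if `ρ(u) = u ⊗ g`. These are the images of `1` under
the homomorphisms `[g]A → X`, so the generator hypothesis says that homomorphisms out of `X` are
determined by their values on `g`-elements, `g ∈ G`. The right submodule `S` spanned by any set of
`g`-elements gives a quotient comodule `X/S`, without flatness, because `u ⊗ g` dies in `X/S ⊗ C`.
Taking all of them, `X → X/S` must be zero, so they span `X` (`span_eq_top_of_isSeparator`). In `C`
itself the left counit law gives `u = ε(u) g`, and `can` is surjective.

For injectivity, map `⨁_{(g,a)} [g]A` onto `ℜ(G)` by `x ↦ a ⊗ x`. A separate copy is needed for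
every left factor `a`, since `[g]A` is only a right module. The composite to `C` is a surjective
comodule map, hence an epimorphism, hence a cokernel in the abelian category. This forces its
set-theoretic kernel to be spanned by `h`-elements, `h ∈ G` (`mem_span_of_map_eq_zero`).

It remains to see that such a `u` already dies in `ℜ(G)`. Its coordinates satisfy `g u_i = u_i h`
(`coord_mem_intertwiner`), so the relations of `ℜ(G)` collapse its image to `(∑ a_i u_i) ⊗ 1` in the
component of `h`. The image of this in `C` is `(∑ a_i u_i) h = 0`, and applying `ε` gives `∑ a_i u_i
= 0` (`coverMap_eq_zero`). -/

/-- A bijective homomorphism of corings is an isomorphism of corings. -/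
theorem CoringHom.isIsomorphism_of_bijective {A : Type u} {C : Type v} {D : Type w} [Ring A]
    [AddCommGroup C] [Module A C] [Module Aᵐᵒᵖ C] [SMulCommClass A Aᵐᵒᵖ C] [ACoring A C]
    [AddCommGroup D] [Module A D] [Module Aᵐᵒᵖ D] [SMulCommClass A Aᵐᵒᵖ D] [ACoring A D]
    (f : CoringHom A C D) (hf : Function.Bijective f.toHom) : f.IsIsomorphism := by
  let e : C ≃+ D := AddEquiv.ofBijective f.toHom hf
  have hs : ∀ c, e.symm (f.toHom c) = c := e.symm_apply_apply
  have hl : ∀ (a : A) (d : D), e.symm (a • d) = a • e.symm d := fun a d => by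
    obtain ⟨c, rfl⟩ := hf.2 d
    rw [← f.map_smul, hs, hs]
  have hr : ∀ (a : A) (d : D), e.symm (op a • d) = op a • e.symm d := fun a d => by
    obtain ⟨c, rfl⟩ := hf.2 d
    rw [← f.map_op_smul, hs, hs]
  refine ⟨⟨e.symm.toAddMonoidHom, hl, hr, fun d => ?_, fun d => ?_⟩, hs, e.apply_symm_apply⟩
  · obtain ⟨c, rfl⟩ := hf.2 d
    -- `f⁻¹ ⊗ f⁻¹` undoes `f ⊗ f`, so comultiplicativity of `f` transfers to the inverse.
    have hc : (BTensor.map (B := A) e.symm.toAddMonoidHom hr e.symm.toAddMonoidHom hl).comp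
        (BTensor.map f.toHom f.map_op_smul f.toHom f.map_smul) = AddMonoidHom.id _ :=
      BTensor.hom_ext fun m n => by
        change BTensor.tmul A (e.symm (f.toHom m)) (e.symm (f.toHom n)) = BTensor.tmul A m n
        rw [hs, hs]
    rw [f.map_comul]
    refine (congrArg ACoring.comul (hs c)).trans ?_
    exact (DFunLike.congr_fun hc (ACoring.comul c)).symm
  · obtain ⟨c, rfl⟩ := hf.2 d
    rw [f.map_counit]
    exact congrArg ACoring.counit (hs c)

/-! ### Quotient comodules -/

namespace RightComodule

variable {A C : Type u} [Ring A] [AddCommGroup C] [Module A C] [Module Aᵐᵒᵖ C]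
  [SMulCommClass A Aᵐᵒᵖ C] [ACoring A C]

/-- The right comodule structure on a right module `Q` that makes a surjective homomorphism of
right modules `p : X → Q` a homomorphism of comodules. -/
def ofSurjective (X : RightComodule A C) {Q : Type u} [AddCommGroup Q] [Module Aᵐᵒᵖ Q]
    (p : X.carrier →+ Q) (hpA : ∀ (a : A) x, p (op a • x) = op a • p x)
    (hp : Function.Surjective p) (r : Q →+ BTensor A Q C)
    (hr : ∀ x, r (p x) = BTensor.map p hpA (AddMonoidHom.id C) (fun _ _ => rfl) (X.coact x)) :
    RightComodule A C :=
  have hrA : ∀ (a : A) m, r (op a • m) = op a • r m := fun a m => by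
    obtain ⟨x, rfl⟩ := hp m
    rw [← hpA, hr, hr, X.coact_op_smul, BTensor.map_op_smul_right]
  { carrier := Q
    coact := r
    coact_op_smul := hrA
    coassoc := fun m => by
      obtain ⟨x, rfl⟩ := hp m
      -- Coassociativity of `r` at `p x` is that of `X` at `x` pushed forward along `p ⊗ C ⊗ C`;
      -- `e1` and `e2` identify the two sides by naturality.
      have h := congrArg (BTensor.map (B := A) p hpA
        (AddMonoidHom.id (BTensor A C C)) (fun _ _ => rfl)) (X.coassoc x)
      have e1 : ∀ y : BTensor A X.carrier C,
          BTensor.map (AddMonoidHom.id _) (fun _ _ => rfl)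
            (ACoring.comul (A := A) (C := C)) ACoring.comul_smul
            (BTensor.map p hpA (AddMonoidHom.id C) (fun _ _ => rfl) y) =
          BTensor.map p hpA (AddMonoidHom.id (BTensor A C C)) (fun _ _ => rfl)
            (BTensor.map (AddMonoidHom.id _) (fun _ _ => rfl)
              (ACoring.comul (A := A) (C := C)) ACoring.comul_smul y) := by
        intro y
        induction y using BTensor.induction with
        | zero => simp
        | tm m n => rfl
        | add x y hx hy => simp only [map_add, hx, hy]
      have e3 : ∀ (z : BTensor A X.carrier C) (c : C),
          BTensor.assoc A _ C C (BTensor.tmul A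
            (BTensor.map p hpA (AddMonoidHom.id C) (fun _ _ => rfl) z) c) =
          BTensor.map p hpA (AddMonoidHom.id (BTensor A C C)) (fun _ _ => rfl)
            (BTensor.assoc A _ C C (BTensor.tmul A z c)) := by
        intro z c
        induction z using BTensor.induction with
        | zero => simp [BTensor.zero_tmul]
        | tm m n => rfl
        | add x y hx hy => simp only [map_add, BTensor.add_tmul, hx, hy]
      have e2 : ∀ y : BTensor A X.carrier C,
          BTensor.assoc A _ C C
            (BTensor.map r hrA (AddMonoidHom.id C) (fun _ _ => rfl)
              (BTensor.map p hpA (AddMonoidHom.id C) (fun _ _ => rfl) y)) =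
          BTensor.map p hpA (AddMonoidHom.id (BTensor A C C)) (fun _ _ => rfl)
            (BTensor.assoc A _ C C
              (BTensor.map X.coact X.coact_op_smul (AddMonoidHom.id C) (fun _ _ => rfl) y)) := by
        intro y
        induction y using BTensor.induction with
        | zero => simp
        | tm m n => simp only [BTensor.map_tmul, AddMonoidHom.id_apply, hr, e3]
        | add x y hx hy => simp only [map_add, hx, hy]
      rw [hr]
      exact (e2 _).trans (h.trans (e1 _).symm)
    counit := fun m => by
      obtain ⟨x, rfl⟩ := hp m
      have e : ∀ y : BTensor A X.carrier C,
          BTensor.contractRight (ACoring.counit (A := A) (C := C)) ACoring.counit_smul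
            (BTensor.map p hpA (AddMonoidHom.id C) (fun _ _ => rfl) y) =
          p (BTensor.contractRight (ACoring.counit (A := A) (C := C)) ACoring.counit_smul y) := by
        intro y
        induction y using BTensor.induction with
        | zero => simp
        | tm m n => simp [hpA]
        | add x y hx hy => simp only [map_add, hx, hy]
      rw [hr, e, X.counit] }

/-- For a set `E` of elements `u` of `X` with `ρ(u) = u ⊗ g` for some `g`, there is a homomorphism
of right comodules whose kernel is the right submodule generated by `E`. -/
theorem exists_hom_ker_eq_span (X : RightComodule A C) (E : Set X.carrier)
    (hE : ∀ u ∈ E, ∃ g : C, X.coact u = BTensor.tmul A u g) :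
    ∃ (Q : RightComodule A C) (q : X ⟶ Q),
      ∀ x, Hom.toHom q x = 0 ↔ x ∈ Submodule.span Aᵐᵒᵖ E := by
  let S := Submodule.span Aᵐᵒᵖ E
  obtain ⟨p, hpA, hp, hker⟩ : ∃ p : X.carrier →+ X.carrier ⧸ S,
      (∀ (a : A) x, p (op a • x) = op a • p x) ∧ Function.Surjective p ∧ ∀ x, p x = 0 ↔ x ∈ S :=
    ⟨S.mkQ.toAddMonoidHom, fun _ _ => rfl, S.mkQ_surjective,
      fun _ => Submodule.Quotient.mk_eq_zero S⟩
  let F : X.carrier →+ BTensor A (X.carrier ⧸ S) C :=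
    (BTensor.map p hpA (AddMonoidHom.id C) (fun _ _ => rfl)).comp X.coact
  -- On a generator, `F u = p u ⊗ g = 0`. Only this vanishing is needed, not a subcomodule structure
  -- on `S`, hence no injectivity of `S ⊗ C → X ⊗ C`.
  have hF : ∀ x ∈ S, F x = 0 := fun x hx => by
    change BTensor.map p hpA (AddMonoidHom.id C) (fun _ _ => rfl) (X.coact x) = 0
    induction hx using Submodule.span_induction with
    | mem u hu =>
      obtain ⟨g, hg⟩ := hE u hu
      rw [hg, BTensor.map_tmul, (hker u).2 (Submodule.subset_span hu), BTensor.zero_tmul]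
    | zero => simp
    | add x y _ _ hx hy => rw [map_add, map_add, hx, hy, add_zero]
    | smul a x _ hx =>
      obtain ⟨a, rfl⟩ := op_surjective a
      rw [X.coact_op_smul, BTensor.map_op_smul_right, hx, smul_zero]
  let r : X.carrier ⧸ S →+ BTensor A (X.carrier ⧸ S) C :=
    p.liftOfSurjective hp ⟨F, fun x hx => hF x ((hker x).1 hx)⟩
  have hr : ∀ x, r (p x) = F x := fun x => p.liftOfRightInverse_comp_apply _ _ _ x
  exact ⟨X.ofSurjective p hpA hp r hr, Hom.mk (N := X.ofSurjective p hpA hp r hr) p hpA hr, hker⟩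

/-! ### Zero homomorphisms, epimorphisms and the regular comodule -/

/-- The zero homomorphism of right comodules. -/
def zeroHom (X Y : RightComodule A C) : X ⟶ Y :=
  Hom.mk 0 (fun a m => by simp) (fun m => by
    have : BTensor.map (B := A) (0 : X.carrier →+ Y.carrier) (fun a m => by simp)
        (AddMonoidHom.id C) (fun _ _ => rfl) = 0 :=
      BTensor.hom_ext fun m n => BTensor.zero_tmul n
    rw [this]; simp)

theorem zeroHom_comp {X Y Z : RightComodule A C} (f : Y ⟶ Z) :
    zeroHom X Y ≫ f = zeroHom X Z :=
  Hom.ext (AddMonoidHom.ext fun _ => map_zero (Hom.toHom f))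

/-- The zero morphisms that come with an abelian structure are abstract. Composing the concrete zero
map with an abstract one yields both, so they agree. -/
theorem zeroHom_eq_zero [Limits.HasZeroMorphisms (RightComodule A C)] (X Y : RightComodule A C) :
    zeroHom X Y = 0 := by
  rw [← zeroHom_comp (X := X) (0 : X ⟶ Y), Limits.comp_zero]

theorem epi_of_surjective {X Y : RightComodule A C} (f : X ⟶ Y)
    (hf : Function.Surjective (Hom.toHom f)) : Epi f where
  left_cancellation {Z} k l h := Hom.ext (AddMonoidHom.ext fun y => by
    obtain ⟨x, rfl⟩ := hf y
    exact DFunLike.congr_fun (congrArg Hom.toHom h) x)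

variable (A C) in
/-- The coring `C` as a right comodule over itself. -/
def regular : RightComodule A C where
  carrier := C
  coact := ACoring.comul
  coact_op_smul := ACoring.comul_op_smul
  coassoc := ACoring.coassoc
  counit := ACoring.counit_right

/-- The left counit law contracts `u ⊗ g` to `ε(u) g`. -/
theorem eq_smul_of_comul_eq {u g : C} (hu : ACoring.comul (A := A) u = BTensor.tmul A u g) :
    u = ACoring.counit (A := A) u • g := by
  have h := ACoring.counit_left (A := A) u
  rw [hu, BTensor.contractLeft_tmul] at h
  exact h.symm

/-! ### Consequences of the generator hypothesis -/

section Separator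

variable {G : Set C} {hG : ∀ g ∈ G, IsGrouplike A g}

/-- If `⨁_{g ∈ G} [g]A` is a separator, then a homomorphism vanishes as soon as it vanishes on
the elements `u` with `ρ(u) = u ⊗ g`, `g ∈ G`. -/
theorem eq_zeroHom_of_isSeparator (hgen : IsSeparator (grouplikeSum G hG))
    {X Y : RightComodule A C} (f : X ⟶ Y)
    (hf : ∀ g ∈ G, ∀ u, X.coact u = BTensor.tmul A u g → Hom.toHom f u = 0) :
    f = zeroHom X Y := by
  let : DecidableEq G := Classical.decEq G
  refine hgen.def _ _ fun φ => Hom.ext (DirectSum.addHom_ext fun g a => ?_)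
  let M : G → RightComodule A C := fun g : G => grouplikeComodule g.1 (hG g.1 g.2)
  let F : (⨁ g, (M g).carrier) →+ X.carrier := Hom.toHom φ
  have hF : ∀ (a : A) x, F (op a • x) = op a • F x := Hom.map_op_smul φ
  let i : A →+ ⨁ g, (M g).carrier := DirectSum.of (fun g => (M g).carrier) g
  have hi : ∀ a b : A, i (b * a) = op a • i b := fun a b => of_op_smul M g a b
  have hs : sumCoact M (i 1) = BTensor.tmul A (i 1) (op (1 : A) • g.1) := sumCoact_of M g (1 : A)
  -- In `[g]A` the coaction sends `1` to `1 ⊗ g`, and comodule maps preserve this. By right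
  -- linearity the image of `1` determines `φ` on this summand.
  have hu : X.coact (F (i 1)) = BTensor.tmul A (F (i 1)) g.1 := by
    have h : X.coact (F (i 1)) = BTensor.map F hF (AddMonoidHom.id C) (fun _ _ => rfl)
      (sumCoact M (i 1)) := Hom.map_coact φ (i 1)
    rw [h, hs, op_one, one_smul]
    rfl
  change Hom.toHom f (F (i a)) = 0
  have ha : i a = op (show A from a) • i 1 := by rw [← hi, one_mul]
  rw [ha, hF, Hom.map_op_smul, hf g.1 g.2 _ hu, smul_zero]

/-- If `⨁_{g ∈ G} [g]A` is a separator, then the elements `u` of `X` with `ρ(u) = u ⊗ g`, `g ∈ G`,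
generate `X` as a right module. -/
theorem span_eq_top_of_isSeparator (hgen : IsSeparator (grouplikeSum G hG))
    (X : RightComodule A C) :
    Submodule.span Aᵐᵒᵖ {u : X.carrier | ∃ g ∈ G, X.coact u = BTensor.tmul A u g} = ⊤ := by
  obtain ⟨Q, q, hq⟩ := X.exists_hom_ker_eq_span
    {u | ∃ g ∈ G, X.coact u = BTensor.tmul A u g} fun u ⟨g, _, hu⟩ => ⟨g, hu⟩
  -- `q` kills precisely the elements on which homomorphisms are tested, so `q = 0` and its kernel,
  -- the span, is everything.
  have h0 := eq_zeroHom_of_isSeparator hgen q fun g hg u hu =>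
    (hq u).2 (Submodule.subset_span ⟨g, hg, hu⟩)
  refine eq_top_iff.2 fun x _ => (hq x).1 ?_
  rw [h0]
  rfl

/-- If `Comod-C` is abelian and `⨁_{g ∈ G} [g]A` is a separator, then the kernel of a surjective
homomorphism `f` is generated as a right module by those `u` with `f(u) = 0` and `ρ(u) = u ⊗ g` for
some `g ∈ G`. -/
theorem mem_span_of_map_eq_zero [Abelian (RightComodule A C)]
    (hgen : IsSeparator (grouplikeSum G hG)) {X Y : RightComodule A C} (f : X ⟶ Y)
    (hf : Function.Surjective (Hom.toHom f)) (x : X.carrier) (hx : Hom.toHom f x = 0) :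
    x ∈ Submodule.span Aᵐᵒᵖ {u : X.carrier | Hom.toHom f u = 0 ∧
      ∃ g ∈ G, X.coact u = BTensor.tmul A u g} := by
  obtain ⟨Q, q, hq⟩ := X.exists_hom_ker_eq_span {u | Hom.toHom f u = 0 ∧
    ∃ g ∈ G, X.coact u = BTensor.tmul A u g} fun u ⟨_, g, _, hu⟩ => ⟨g, hu⟩
  have := epi_of_surjective f hf
  -- Abelianness enters here: `f` is the cokernel of some `N.g`. The categorical kernel of `f` is
  -- never compared with the set-theoretic one, which may differ without flatness.
  let N : NormalEpi f := normalEpiOfEpi f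
  have hN : ∀ v, Hom.toHom f (Hom.toHom N.g v) = 0 := fun v => by
    have h := N.w
    rw [← zeroHom_eq_zero] at h
    exact DFunLike.congr_fun (congrArg Hom.toHom h) v
  -- `N.g` carries an element with `ρ(u) = u ⊗ g` to one of the same kind, lying in the kernel of
  -- `f`, and `q` kills those by construction.
  have hNq : N.g ≫ q = 0 := by
    rw [← zeroHom_eq_zero]
    refine eq_zeroHom_of_isSeparator hgen _ fun g hg u hu =>
      (hq _).2 (Submodule.subset_span ⟨hN u, g, hg, ?_⟩)
    rw [Hom.map_coact, hu]
    rfl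
  -- Factoring `q` through the cokernel `f` shows that everything killed by `f` is killed by `q`.
  obtain ⟨l, hl⟩ := NormalEpi.desc' f q hNq
  refine (hq x).1 ?_
  rw [← hl]
  change Hom.toHom l (Hom.toHom f x) = 0
  rw [hx, map_zero]

end Separator

end RightComodule

/-! ### Surjectivity of `can`, and a cover of `ℜ(G)` by copies of `A` -/

namespace CanonicalCoring

open RightComodule

variable {A C : Type u} [Ring A] [AddCommGroup C] [Module A C] [Module Aᵐᵒᵖ C]
  [SMulCommClass A Aᵐᵒᵖ C]

section CoverMap

variable (G : Set C)

variable (A) in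
/-- The group `⨁_{(g, a)} A` with `g ∈ G` and `a ∈ A`. -/
abbrev CoverCarrier : Type u := ⨁ _ : G × A, A

open Classical in
/-- The map `⨁_{(g, a)} A → ℜ(G)` sending `x` in component `(g, a)` to `a ⊗ x`. -/
noncomputable def coverMap : CoverCarrier A G →+ CanonicalCoring A G :=
  DirectSum.toAddMonoid fun i => AddMonoidHom.mk' (fun x => mk i.1 i.2 x)
    (mk_add_right _ _)

open Classical in
theorem coverMap_of (i : G × A) (x : A) :
    coverMap G (DirectSum.of (fun _ => A) i x) = mk i.1 i.2 x :=
  DirectSum.toAddMonoid_of _ _ _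

theorem coverMap_op_smul (b : A) (x : CoverCarrier A G) :
    coverMap G (op b • x) = op b • coverMap G x := by
  classical
  induction x using DirectSum.induction_on with
  | zero => simp
  | of i x =>
    have h : op b • DirectSum.of (fun _ : G × A => A) i x =
        DirectSum.of (fun _ : G × A => A) i (x * b) :=
      ((DirectSum.lof Aᵐᵒᵖ (G × A) (fun _ => A) i).map_smul (op b) x).symm
    rw [h, coverMap_of, coverMap_of, op_smul_mk]
  | add x y hx hy => rw [smul_add, map_add, map_add, smul_add, hx, hy]

theorem coverMap_surjective : Function.Surjective (coverMap (A := A) G) := by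
  classical
  intro x
  induction x using induction with
  | zero => exact ⟨0, map_zero _⟩
  | mk g a a' => exact ⟨_, coverMap_of G (g, a) a'⟩
  | add x y hx hy =>
    obtain ⟨x, rfl⟩ := hx
    obtain ⟨y, rfl⟩ := hy
    exact ⟨x + y, map_add _ _ _⟩

end CoverMap

variable [ACoring A C]

/-- The image of `can` is a right submodule of `C`, and it contains the spanning elements `u = ε(u)
g` of the regular comodule. -/
theorem can_surjective (G : Set C) (hG : ∀ g ∈ G, IsGrouplike A g)
    (hgen : IsSeparator (grouplikeSum G hG)) : Function.Surjective (can G hG).toHom := by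
  intro c
  have hc : c ∈ Submodule.span Aᵐᵒᵖ {u : C | ∃ g ∈ G,
      ACoring.comul (A := A) u = BTensor.tmul A u g} := by
    rw [show Submodule.span Aᵐᵒᵖ {u : C | ∃ g ∈ G,
      ACoring.comul (A := A) u = BTensor.tmul A u g} = ⊤ from
        span_eq_top_of_isSeparator hgen (regular A C)]
    trivial
  induction hc using Submodule.span_induction with
  | mem u hu =>
    obtain ⟨g, hg, hu⟩ := hu
    refine ⟨mk ⟨g, hg⟩ (ACoring.counit (A := A) u) 1, ?_⟩
    change canAddHom G _ = u
    rw [canAddHom_mk, op_one, one_smul, ← eq_smul_of_comul_eq hu]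
  | zero => exact ⟨0, map_zero _⟩
  | add x y _ _ hx hy =>
    obtain ⟨x, rfl⟩ := hx
    obtain ⟨y, rfl⟩ := hy
    exact ⟨x + y, map_add _ _ _⟩
  | smul a x _ hx =>
    obtain ⟨a, rfl⟩ := op_surjective a
    obtain ⟨x, rfl⟩ := hx
    exact ⟨op a • x, (can G hG).map_op_smul a x⟩

/-! ### The cover as a comodule, and its elements with `ρ(u) = u ⊗ h` -/

section Cover

variable (G : Set C) (hG : ∀ g ∈ G, IsGrouplike A g)

open Classical in
/-- The comodule `⨁_{(g, a)} [g]A` with `g ∈ G` and `a ∈ A`. -/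
noncomputable def cover : RightComodule A C :=
  directSum fun i : G × A => grouplikeComodule i.1.1 (hG i.1.1 i.1.2)

open Classical in
theorem cover_coact_of (i : G × A) (x : A) :
    (cover G hG).coact (DirectSum.of (fun _ => A) i x) =
      BTensor.tmul A (M := CoverCarrier A G) (DirectSum.of (fun _ => A) i 1) (op x • i.1.1) :=
  sumCoact_of (fun i : G × A => grouplikeComodule i.1.1 (hG i.1.1 i.1.2)) i x

/-- The comodule homomorphism `⨁_{(g, a)} [g]A → C` sending `x` in component `(g, a)` to `a g x`. -/
noncomputable def coverHom : cover G hG ⟶ regular A C :=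
  have hA : ∀ (a : A) (m : CoverCarrier A G), (canAddHom G).comp (coverMap G) (op a • m) =
      op a • (canAddHom G).comp (coverMap G) m := fun a m => by
    rw [AddMonoidHom.comp_apply, coverMap_op_smul]
    exact (can G hG).map_op_smul a _
  -- Both sides send `x` in component `(g, a)` to `a g ⊗ g x`.
  have hco : (ACoring.comul (A := A)).comp ((canAddHom G).comp (coverMap G)) =
      (BTensor.map ((canAddHom G).comp (coverMap G)) hA (AddMonoidHom.id C) (fun _ _ => rfl)).comp
        (show CoverCarrier A G →+ BTensor A (CoverCarrier A G) C from (cover G hG).coact) := by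
    classical
    refine DirectSum.addHom_ext fun i x => ?_
    refine Eq.trans ?_ (congrArg (BTensor.map ((canAddHom G).comp (coverMap G)) hA
      (AddMonoidHom.id C) (fun _ _ => rfl)) (cover_coact_of G hG i x)).symm
    rw [BTensor.map_tmul]
    simp only [AddMonoidHom.comp_apply, coverMap_of, canAddHom_mk, ACoring.comul_smul,
      ACoring.comul_op_smul, (hG i.1.1 i.1.2).comul, op_one, one_smul, AddMonoidHom.id_apply]
    rfl
  Hom.mk (M := cover G hG) (N := regular A C) ((canAddHom G).comp (coverMap G)) hA
    (DFunLike.congr_fun hco)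

/-- The `i`-th coordinate of an element `u` of `⨁_{(g, a)} [g]A` with `ρ(u) = u ⊗ h` intertwines
`h` and `g`. -/
theorem coord_mem_intertwiner (h : C) (u : CoverCarrier A G)
    (hu : (cover G hG).coact u = BTensor.tmul A (M := CoverCarrier A G) u h) (i : G × A) :
    u i ∈ intertwiner A h i.1.1 := by
  classical
  let π : CoverCarrier A G →+ A := DFinsupp.evalAddMonoidHom i
  let c : BTensor A (CoverCarrier A G) C →+ C := BTensor.contractLeft π fun _ _ => rfl
  -- Contracting with the `i`-th coordinate turns `ρ(u)` into `g u_i`, where `g` is the grouplike of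
  -- index `i`, and turns `u ⊗ h` into `u_i h`.
  have key : c.comp (show CoverCarrier A G →+ BTensor A (CoverCarrier A G) C from
      (cover G hG).coact) =
      (AddMonoidHom.mk' (fun a : A => op a • i.1.1) fun a b => by
        rw [MulOpposite.op_add, add_smul]).comp π := by
    refine DirectSum.addHom_ext fun j x => ?_
    refine (congrArg c (cover_coact_of G hG j x)).trans ?_
    change DirectSum.of (fun _ : G × A => A) j 1 i • op x • j.1.1 =
      op (DirectSum.of (fun _ : G × A => A) j x i) • i.1.1
    obtain rfl | hij := eq_or_ne j i
    · rw [DirectSum.of_eq_same, DirectSum.of_eq_same, one_smul]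
    · rw [DirectSum.of_eq_of_ne _ _ _ hij.symm, DirectSum.of_eq_of_ne _ _ _ hij.symm, zero_smul,
        MulOpposite.op_zero, zero_smul]
  exact ((DFunLike.congr_fun key u).symm.trans (congrArg c hu) :)

/-- Each term `a_i ⊗ u_i` can be moved by a defining relation to `a_i u_i ⊗ 1` in the one component
`h`. On elements `b ⊗ 1` of that component `can` is injective, because `ε(b h) = b`. -/
theorem coverMap_eq_zero (hG : ∀ g ∈ G, IsGrouplike A g) (h : G) (u : CoverCarrier A G)
    (hu : ∀ i, u i ∈ intertwiner A h.1 i.1.1) (h0 : canAddHom G (coverMap G u) = 0) :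
    coverMap G u = 0 := by
  classical
  have key : coverMap G u = mk h (∑ i ∈ u.support, i.2 * u i) 1 := by
    let m : A →+ CanonicalCoring A G := AddMonoidHom.mk' (fun a => mk h a 1) fun a b =>
      mk_add_left h a b 1
    change _ = m _
    conv_lhs => rw [← DirectSum.sum_support_of u]
    rw [map_sum, map_sum]
    refine Finset.sum_congr rfl fun i _ => ?_
    rw [coverMap_of, ← mul_one (u i), mk_intertwine h i.1 (u i) (hu i), mul_one]
    rfl
  rw [key, canAddHom_mk, op_one, one_smul] at h0
  have h1 := congrArg (ACoring.counit (A := A)) h0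
  rw [ACoring.counit_smul, (hG h.1 h.2).counit, mul_one, map_zero] at h1
  rw [key, h1, mk_zero_left]

end Cover

/-- A class killed by `can` lifts to the cover, where the lift lies in the kernel of `coverHom`.
Since that kernel is spanned by elements with `ρ(u) = u ⊗ g` and `coverMap` is right linear,
checking such elements suffices. -/
theorem can_injective [Abelian (RightComodule A C)] (G : Set C) (hG : ∀ g ∈ G, IsGrouplike A g)
    (hgen : IsSeparator (grouplikeSum G hG)) : Function.Injective (can G hG).toHom := by
  refine (injective_iff_map_eq_zero _).2 fun z hz => ?_
  obtain ⟨x, rfl⟩ := coverMap_surjective G z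
  have hx := mem_span_of_map_eq_zero hgen (coverHom G hG)
    ((can_surjective G hG hgen).comp (coverMap_surjective G)) x hz
  change coverMap G x = 0
  clear hz
  induction hx using Submodule.span_induction with
  | mem u hu =>
    obtain ⟨h0, g, hg, hu⟩ := hu
    exact coverMap_eq_zero G hG ⟨g, hg⟩ u (coord_mem_intertwiner G hG g u hu) h0
  | zero => exact map_zero _
  | add x y _ _ hx hy =>
    exact (map_add (coverMap G) (x : CoverCarrier A G) y).trans (by rw [hx, hy, add_zero])
  | smul a x _ hx =>
    obtain ⟨a, rfl⟩ := op_surjective a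
    exact (coverMap_op_smul G a x).trans (by rw [hx, smul_zero])

end CanonicalCoring

theorem mainTheorem5 {A C : Type u} [Ring A] [AddCommGroup C] [Module A C] [Module Aᵐᵒᵖ C]
    [SMulCommClass A Aᵐᵒᵖ C] [ACoring A C]
    (hab : Nonempty (Abelian (RightComodule A C)))
    (G : Set C) (hG : ∀ g ∈ G, IsGrouplike A g)
    (hgen : IsSeparator (grouplikeSum G hG)) :
    (CanonicalCoring.can G hG).IsIsomorphism := by
  obtain ⟨_⟩ := hab
  exact CoringHom.isIsomorphism_of_bijective _
    ⟨CanonicalCoring.can_injective G hG hgen, CanonicalCoring.can_surjective G hG hgen⟩
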